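/- Write $[x,y]=x^{-1}y^{-1}xy$. A string C-group of rank $d$ is a pair $(G,\{\rho_0,\dots,\rho_{d-1}\})$ where $G$ is a group generated by the involutions $\rho_0,\dots,\rho_{d-1}$ such that $\rho_i$ and $\rho_j$ commute whenever $|i-j|>1$, and $G_I\cap G_J=G_{I\cap J}$ for all $I,J\subseteq\{0,\dots,d-1\}$, where $G_I=\langle\rho_i : i\in I\rangle$. Its order is $|G|$, and its Schläfli type is $\{p_1,\dots,p_{d-1}\}$, where $p_i$ is the order of $\rho_{i-1}\rho_i$. Let $n\ge 10$ be an integer and let $$G_1=\langle \rho_0,\rho_1,\rho_2 \mid \rho_0^2,\ \rho_1^2,\ \rho_2^2,\ (\rho_0\rho_1)^{2^2},\ (\rho_1\rho_2)^{2^{n-3}},\ (\rho_0\rho_2)^2,\ [(\rho_0\rho_1)^2,\rho_2]\rangle,$$ $$G_3=\langle \rho_0,\rho_1,\rho_2 \mid \rho_0^2,\ \rho_1^2,\ \rho_2^2,\ (\rho_0\rho_1)^{2^2},\ (\rho_1\rho_2)^{2^{n-4}},\ (\rho_0\rho_2)^2,\ [(\rho_0\rho_1)^2,(\rho_1\rho_2)^2]\rangle,$$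 $$G_5=\langle \rho_0,\rho_1,\rho_2 \mid \rho_0^2,\ \rho_1^2,\ \rho_2^2,\ (\rho_0\rho_1)^{2^2},\ (\rho_1\rho_2)^{2^{n-5}},\ (\rho_0\rho_2)^2,\ [\rho_0,(\rho_1\rho_2)^2]^2,\ [\rho_0,(\rho_1\rho_2)^4]\rangle.$$ Then the pairs $(G_1,\{\rho_0,\rho_1,\rho_2\})$, $(G_3,\{\rho_0,\rho_1,\rho_2\})$ and $(G_5,\{\rho_0,\rho_1,\rho_2\})$ are string C-groups of order $2^n$ with Schläfli types $\{4,2^{n-3}\}$, $\{4,2^{n-4}\}$ and $\{4,2^{n-5}\}$, respectively. -/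

import Mathlib

namespace StringCGroup

/-- The commutator in the convention `[x, y] = x⁻¹ y⁻¹ x y`
(Mathlib's `⁅x, y⁆` is `x y x⁻¹ y⁻¹`). -/
def comm {G : Type*} [Group G] (x y : G) : G := x⁻¹ * y⁻¹ * x * y

/-- For `I ⊆ {0, …, d-1}`, the subgroup `G_I` generated by the `ρ i` with `i ∈ I`. -/
def parabolic {G : Type*} [Group G] {d : ℕ} (ρ : Fin d → G) (I : Set (Fin d)) : Subgroup G :=
  Subgroup.closure (ρ '' I)

/-- `(G, {ρ 0, …, ρ (d-1)})` is a string C-group of rank `d`. -/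
structure IsStringCGroup {G : Type*} [Group G] {d : ℕ} (ρ : Fin d → G) : Prop where
  /-- The `ρ i` are involutions. -/
  involution : ∀ i, orderOf (ρ i) = 2
  /-- The `ρ i` generate `G`. -/
  generate : Subgroup.closure (Set.range ρ) = ⊤
  /-- The string property: `ρ i` and `ρ j` commute whenever `|i - j| > 1`. -/
  string : ∀ i j : Fin d, 1 < |(i : ℤ) - (j : ℤ)| → Commute (ρ i) (ρ j)
  /-- The intersection property: `G_I ∩ G_J = G_{I ∩ J}` for all `I, J`. -/
  intersection : ∀ I J : Set (Fin d), parabolic ρ I ⊓ parabolic ρ J = parabolic ρ (I ∩ J)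

/-- The pair has Schläfli type `{p 0, …, p (d-1)}` (rank `d + 1`): the order of
`ρ i * ρ (i+1)` is `p i`. -/
def HasSchlafliType {G : Type*} [Group G] {d : ℕ} (ρ : Fin (d + 1) → G) (p : Fin d → ℕ) : Prop :=
  ∀ i : Fin d, orderOf (ρ i.castSucc * ρ i.succ) = p i

/-- The free generators `ρ₀, ρ₁, ρ₂`. -/
abbrev x (i : Fin 3) : FreeGroup (Fin 3) := FreeGroup.of i

/-- The relators `ρ₀², ρ₁², ρ₂², (ρ₀ρ₁)^(2²), (ρ₁ρ₂)^(2^t), (ρ₀ρ₂)²`. -/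
def baseRels (t : ℕ) : Set (FreeGroup (Fin 3)) :=
  {x 0 ^ 2, x 1 ^ 2, x 2 ^ 2, (x 0 * x 1) ^ 2 ^ 2, (x 1 * x 2) ^ 2 ^ t, (x 0 * x 2) ^ 2}

/-- Relators of `G₁`. -/
def rels₁ (n : ℕ) : Set (FreeGroup (Fin 3)) :=
  baseRels (n - 3) ∪ {comm ((x 0 * x 1) ^ 2) (x 2)}

/-- Relators of `G₃`. -/
def rels₃ (n : ℕ) : Set (FreeGroup (Fin 3)) :=
  baseRels (n - 4) ∪ {comm ((x 0 * x 1) ^ 2) ((x 1 * x 2) ^ 2)}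

/-- Relators of `G₅`. -/
def rels₅ (n : ℕ) : Set (FreeGroup (Fin 3)) :=
  baseRels (n - 5) ∪ {comm (x 0) ((x 1 * x 2) ^ 2) ^ 2, comm (x 0) ((x 1 * x 2) ^ 4)}

/-- The group `G₁` of parameter `n`. -/
abbrev G₁ (n : ℕ) : Type := PresentedGroup (rels₁ n)

/-- The group `G₃` of parameter `n`. -/
abbrev G₃ (n : ℕ) : Type := PresentedGroup (rels₃ n)

/-- The group `G₅` of parameter `n`. -/
abbrev G₅ (n : ℕ) : Type := PresentedGroup (rels₅ n)

/-- The images `ρ₀, ρ₁, ρ₂` of the free generators in a presented group. -/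
def gen (R : Set (FreeGroup (Fin 3))) : Fin 3 → PresentedGroup R := PresentedGroup.of

end StringCGroup

/-! Write `a`, `b`, `c` for the generators and `2 ^ t` for the prescribed order of `bc`. Killing `a`
gives a map `π` onto the dihedral group of order `2 * 2 ^ t`, and the relations on `b`, `c` alone
split it. So the group is `N ⋊ ⟨b, c⟩`, with `N` the normal closure of `a`.

The string C-group axioms and the Schläfli type follow from `π` and `(ab)² ≠ 1`
(`isStringCGroup_and_hasSchlafliType`): `π` is injective on `⟨b, c⟩`, and this forces the
intersection property (`parabolic_inf_parabolic`).

For the order (`card_eq_card_closure_mul`), the extra relators make `N` an elementary abelian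
2-group generated by two, three or four conjugates of `a`, for `G₁`, `G₃`, `G₅` respectively. A
signed permutation representation shows these conjugates to be independent (`card_closure_insert`).
Thus `|N|` is 4, 8 or 16, and `|N| * 2 * 2 ^ t = 2 ^ n` each time. -/

namespace StringCGroup

open DihedralGroup

/-! ### The intersection property from a quotient killing `ρ 0` -/

section Intersection

variable {G K : Type*} [Group G] [Group K]

theorem mem_closure_singleton_of_sq {x y : G} (hx : x ^ 2 = 1)
    (hy : y ∈ Subgroup.closure {x}) : y = 1 ∨ y = x := by
  induction hy using Subgroup.closure_induction with
  | mem y hy => exact Or.inr hy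
  | one => exact Or.inl rfl
  | mul y z _ _ hy hz =>
    rcases hy with rfl | rfl <;> rcases hz with rfl | rfl <;> simp [← pow_two, hx]
  | inv y _ hy =>
    rcases hy with rfl | rfl
    · simp
    · exact Or.inr (inv_eq_of_mul_eq_one_left (by rw [← pow_two, hx]))

theorem exists_mul_of_mem_closure_pair {x y z : G} (hxy : Commute x y)
    (hz : z ∈ Subgroup.closure {x, y}) :
    ∃ i j : ℤ, z = x ^ i * y ^ j := by
  induction hz using Subgroup.closure_induction with
  | mem z hz =>
    rcases hz with rfl | rfl
    · exact ⟨1, 0, by simp⟩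
    · exact ⟨0, 1, by simp⟩
  | one => exact ⟨0, 0, by simp⟩
  | mul z w _ _ hz hw =>
    obtain ⟨i, j, rfl⟩ := hz
    obtain ⟨k, l, rfl⟩ := hw
    exact ⟨i + k, j + l, by
      rw [zpow_add, zpow_add, (hxy.symm.zpow_zpow j k).mul_mul_mul_comm]⟩
  | inv z _ hz =>
    obtain ⟨i, j, rfl⟩ := hz
    exact ⟨-i, -j, by rw [mul_inv_rev, zpow_neg, zpow_neg, (hxy.zpow_zpow i j).inv_inv.eq]⟩

theorem parabolic_mono {d : ℕ} (ρ : Fin d → G) {I J : Set (Fin d)} (h : I ⊆ J) :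
    parabolic ρ I ≤ parabolic ρ J :=
  Subgroup.closure_mono (Set.image_mono h)

/-- If `π` kills `ρ 0`, then modulo `π` every element of `G_I` lies in `G_{I \ {0}}`. -/
theorem exists_mem_parabolic_diff {ρ : Fin 3 → G} {π : G →* K} (h0 : π (ρ 0) = 1)
    {I : Set (Fin 3)} {x : G} (hx : x ∈ parabolic ρ I) :
    ∃ d ∈ parabolic ρ (I \ {0}), π x = π d := by
  induction hx using Subgroup.closure_induction with
  | mem x hx =>
    obtain ⟨i, hi, rfl⟩ := hx
    by_cases h : i = 0
    · exact ⟨1, one_mem _, by rw [h, h0, map_one]⟩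
    · exact ⟨ρ i, Subgroup.subset_closure ⟨i, ⟨hi, h⟩, rfl⟩, rfl⟩
  | one => exact ⟨1, one_mem _, rfl⟩
  | mul x y _ _ hx hy =>
    obtain ⟨d, hd, hxd⟩ := hx
    obtain ⟨e, he, hye⟩ := hy
    exact ⟨d * e, mul_mem hd he, by simp [hxd, hye]⟩
  | inv x _ hx =>
    obtain ⟨d, hd, hxd⟩ := hx
    exact ⟨d⁻¹, inv_mem hd, by simp [hxd]⟩

/-- The intersection property, when `π` kills `ρ 0` and is injective on `⟨ρ 1, ρ 2⟩`. -/
theorem parabolic_inf_parabolic {ρ : Fin 3 → G} (π : G →* K) (h0 : π (ρ 0) = 1)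
    (hinj : ∀ x ∈ parabolic ρ {1, 2}, π x = 1 → x = 1)
    (hsq : ∀ i, ρ i ^ 2 = 1) (hcomm : Commute (ρ 0) (ρ 2))
    (h1 : π (ρ 1) ≠ 1) (h2 : π (ρ 2) ≠ 1) (h12 : π (ρ 1) ≠ π (ρ 2)) (I J : Set (Fin 3)) :
    parabolic ρ I ⊓ parabolic ρ J = parabolic ρ (I ∩ J) := by
  have mem_single {i : Fin 3} {x : G} (hx : x ∈ parabolic ρ {i}) : x = 1 ∨ x = ρ i := by
    rw [parabolic, Set.image_singleton] at hx
    exact mem_closure_singleton_of_sq (hsq i) hx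
  have le_of_subset {I J : Set (Fin 3)} (h : I ⊆ J ∨ J ⊆ I) :
      parabolic ρ I ⊓ parabolic ρ J ≤ parabolic ρ (I ∩ J) := by
    rcases h with h | h
    · rw [Set.inter_eq_left.2 h]; exact inf_le_left
    · rw [Set.inter_eq_right.2 h]; exact inf_le_right
  have drop {I J : Set (Fin 3)} (hI : 0 ∉ I) {x : G} (hxI : x ∈ parabolic ρ I)
      (hxJ : x ∈ parabolic ρ J) : x ∈ parabolic ρ (J \ {0}) := by
    obtain ⟨d, hd, hxd⟩ := exists_mem_parabolic_diff h0 hxJ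
    have hsub {L : Set (Fin 3)} (hL : 0 ∉ L) : L ⊆ {1, 2} := by
      intro i hi
      fin_cases i
      · exact absurd hi hL
      · simp
      · simp
    -- Both `x` and `d` lie in `⟨ρ 1, ρ 2⟩` and agree under `π`, so they are equal.
    have : x * d⁻¹ = 1 := hinj _ (mul_mem (parabolic_mono ρ (hsub hI) hxI)
      (inv_mem (parabolic_mono ρ (hsub (by simp)) hd))) (by simp [hxd])
    rwa [mul_inv_eq_one.1 this]
  have one_two {x y : G} (hx : x ∈ parabolic ρ {1}) (hy : y ∈ parabolic ρ {2})
      (hxy : π x = π y) : x = 1 ∧ y = 1 := by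
    rcases mem_single hx with rfl | rfl <;> rcases mem_single hy with rfl | rfl
    · simp
    · exact absurd (by simpa using hxy.symm) h2
    · exact absurd (by simpa using hxy) h1
    · exact absurd hxy h12
  have avoid {I J : Set (Fin 3)} (hI : 0 ∉ I) (hJ : 0 ∉ J) :
      parabolic ρ I ⊓ parabolic ρ J ≤ parabolic ρ (I ∩ J) := by
    by_cases h : I ⊆ J ∨ J ⊆ I
    · exact le_of_subset h
    have cases_eq : (I = {1} ∧ J = {2}) ∨ (I = {2} ∧ J = {1}) := by
      simp only [Set.subset_def, Set.ext_iff, Fin.forall_fin_succ, Fin.forall_fin_zero] at *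
      simp at *
      tauto
    rintro x ⟨hxI, hxJ⟩
    rcases cases_eq with ⟨rfl, rfl⟩ | ⟨rfl, rfl⟩
    · rw [(one_two hxI hxJ rfl).1]; exact one_mem _
    · rw [(one_two hxJ hxI rfl).1]; exact one_mem _
  -- Here `π x` is a power of both `π (ρ 1)` and `π (ρ 2)`, hence trivial; so the `ρ 2` part of `x =
  -- ρ 0 ^ i * ρ 2 ^ j` vanishes.
  have both {x : G} (h01 : x ∈ parabolic ρ {0, 1}) (h02 : x ∈ parabolic ρ {0, 2}) :
      x ∈ parabolic ρ {0} := by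
    obtain ⟨d, hd, hxd⟩ := exists_mem_parabolic_diff h0 h01
    obtain ⟨e, he, hxe⟩ := exists_mem_parabolic_diff h0 h02
    have hd' : d ∈ parabolic ρ {1} := parabolic_mono ρ (by simp) hd
    have he' : e ∈ parabolic ρ {2} := parabolic_mono ρ (by simp) he
    rw [(one_two hd' he' (hxd.symm.trans hxe)).1, map_one] at hxd
    rw [parabolic, Set.image_pair] at h02
    obtain ⟨i, j, rfl⟩ := exists_mul_of_mem_closure_pair hcomm h02
    have hmem {i : Fin 3} : ρ i ∈ parabolic ρ {i} := Subgroup.subset_closure ⟨i, rfl, rfl⟩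
    rcases mem_single (zpow_mem hmem j) with hj | hj
    · rw [hj, mul_one]
      exact zpow_mem hmem i
    · rw [hj, map_mul, map_zpow, h0, one_zpow, one_mul] at hxd
      exact absurd hxd h2
  refine le_antisymm ?_ (le_inf (parabolic_mono ρ Set.inter_subset_left)
    (parabolic_mono ρ Set.inter_subset_right))
  rintro x ⟨hxI, hxJ⟩
  by_cases hI : 0 ∈ I
  · by_cases hJ : 0 ∈ J
    · by_cases h : I ⊆ J ∨ J ⊆ I
      · exact le_of_subset h ⟨hxI, hxJ⟩
      have cases_eq : (I = {0, 1} ∧ J = {0, 2}) ∨ (I = {0, 2} ∧ J = {0, 1}) := by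
        simp only [Set.subset_def, Set.ext_iff, Fin.forall_fin_succ, Fin.forall_fin_zero] at *
        simp at *
        tauto
      have hmem : x ∈ parabolic ρ {0} := by
        rcases cases_eq with ⟨rfl, rfl⟩ | ⟨rfl, rfl⟩
        · exact both hxI hxJ
        · exact both hxJ hxI
      exact parabolic_mono ρ (by simp [hI, hJ]) hmem
    · exact parabolic_mono ρ (by grind) (avoid (by simp) hJ ⟨drop hJ hxJ hxI, hxJ⟩)
  · exact parabolic_mono ρ (by grind) (avoid hI (by simp) ⟨hxI, drop hI hxI hxJ⟩)

end Intersection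

/-! ### Homomorphisms out of dihedral groups -/

section Dihedral

variable {G : Type*} [Group G]

/-- The homomorphism out of a dihedral group given by two involutions `b`, `c` with
`(b * c) ^ m = 1`. -/
def dihedralHom (m : ℕ) (b c : G) (hb : b ^ 2 = 1) (hc : c ^ 2 = 1) (h : (b * c) ^ m = 1) :
    DihedralGroup m →* G :=
  let e : ZMod m →+ Additive G :=
    ZMod.lift m ⟨zmultiplesHom (Additive G) (Additive.ofMul (b * c)), by
      rw [zmultiplesHom_apply, natCast_zsmul, ← ofMul_pow, h, ofMul_one]⟩
  have he (k : ℤ) : (e k).toMul = (b * c) ^ k := by simp [e]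
  have hconj (i : ZMod m) : (e i).toMul * b = b * (e (-i)).toMul := by
    obtain ⟨k, rfl⟩ := ZMod.intCast_surjective i
    rw [← Int.cast_neg, he, he, zpow_neg, ← inv_zpow]
    have hb' : b⁻¹ = b := inv_eq_of_mul_eq_one_left (by rw [← pow_two, hb])
    have hc' : c⁻¹ = c := inv_eq_of_mul_eq_one_left (by rw [← pow_two, hc])
    have : SemiconjBy b (b * c)⁻¹ (b * c) := by
      rw [SemiconjBy, mul_inv_rev, hb', hc']
      group
    exact (this.zpow_right k).eq.symm
  { toFun := fun
      | r i => (e i).toMul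
      | sr i => b * (e i).toMul
    map_one' := by
      change (e 0).toMul = 1
      simp
    map_mul' := by
      rintro (i | i) (j | j)
      · simp
      · simp only [r_mul_sr]
        rw [← mul_assoc, hconj, mul_assoc, ← toMul_add, ← map_add, neg_add_eq_sub]
      · simp [mul_assoc]
      · simp only [sr_mul_sr]
        rw [mul_assoc, ← mul_assoc _ b, hconj, mul_assoc, ← mul_assoc, ← pow_two, hb, one_mul,
          ← toMul_add, ← map_add, neg_add_eq_sub] }

variable {m : ℕ} {b c : G} (hb : b ^ 2 = 1) (hc : c ^ 2 = 1) (h : (b * c) ^ m = 1)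

theorem dihedralHom_sr_zero : dihedralHom m b c hb hc h (sr 0) = b := by
  change b * _ = b
  simp

theorem dihedralHom_sr_one : dihedralHom m b c hb hc h (sr 1) = c := by
  have := ZMod.lift_coe m (⟨zmultiplesHom (Additive G) (Additive.ofMul (b * c)), by
      rw [zmultiplesHom_apply, natCast_zsmul, ← ofMul_pow, h, ofMul_one]⟩ : {f : ℤ →+ Additive G // f m = 0}) 1
  change b * Additive.toMul (ZMod.lift m _ 1) = c
  rw [Int.cast_one] at this
  rw [this]
  simp [← mul_assoc, ← pow_two, hb]

end Dihedral

/-! ### Counting: direct and semidirect products -/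

section Card

variable {G X : Type*} [Group G]

/-- Adjoining an involution that commutes with `S` and is moved off `⟨S⟩` by a permutation
representation doubles the order. -/
theorem card_closure_insert (θ : G →* Equiv.Perm X) (p : X) {t : G} {S : Set G} (ht : t ^ 2 = 1)
    (hcomm : ∀ s ∈ S, Commute t s) (hS : ∀ s ∈ S, θ s p = p) (hp : θ t p ≠ p) :
    Nat.card (Subgroup.closure (insert t S)) = 2 * Nat.card (Subgroup.closure S) := by
  have hfix (s : G) (hs : s ∈ Subgroup.closure S) : θ s p = p := by
    induction hs using Subgroup.closure_induction with
    | mem s hs => exact hS s hs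
    | one => simp
    | mul x y _ _ hx hy => simp [hx, hy]
    | inv x _ hx => rw [map_inv, Equiv.Perm.inv_eq_iff_eq, hx]
  have ht1 : t ≠ 1 := by rintro rfl; simp at hp
  have hc (x : Subgroup.closure {t}) (y : Subgroup.closure S) :
      Commute ((Subgroup.closure {t}).subtype x) ((Subgroup.closure S).subtype y) := by
    have hcent : Subgroup.closure S ≤ Subgroup.centralizer {t} := by
      rw [Subgroup.closure_le]
      intro s hs
      rw [SetLike.mem_coe, Subgroup.mem_centralizer_singleton_iff]
      exact (hcomm s hs).eq.symm
    have := Subgroup.mem_centralizer_singleton_iff.1 (hcent y.2)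
    rcases mem_closure_singleton_of_sq ht x.2 with h | h
    · simp [h]
    · simp only [Subgroup.subtype_apply, h]
      exact this.symm
  -- The product map `⟨t⟩ × ⟨S⟩ → G` is injective because `⟨S⟩` fixes `p` while `t` moves it.
  have hinj := (MonoidHom.noncommCoprod_injective (comm := hc)).2
    ⟨Subgroup.subtype_injective _, Subgroup.subtype_injective _, by
      rw [Subgroup.range_subtype, Subgroup.range_subtype, Subgroup.disjoint_def]
      intro x hx hxS
      rcases mem_closure_singleton_of_sq ht hx with rfl | rfl
      · rfl
      · exact absurd (hfix _ hxS) hp⟩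
  have hrange := MonoidHom.noncommCoprod_range (comm := hc)
  rw [Subgroup.range_subtype, Subgroup.range_subtype, ← Subgroup.closure_union,
    ← Set.insert_eq] at hrange
  rw [← hrange, ← Nat.card_congr (MonoidHom.ofInjective hinj).toEquiv, Nat.card_prod,
    ← Subgroup.zpowers_eq_closure, Nat.card_zpowers, orderOf_eq_prime ht ht1]

/-- If `⟨S⟩` is normal, lies in the kernel of `π` and together with the image of a section of `π`
generates `G`, then `G` is a semidirect product of `⟨S⟩` by the target of `π`. -/
theorem card_eq_card_mul_of_section {K : Type*} [Group K] (π : G →* K) (σ : K →* G)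
    (hσ : ∀ k, π (σ k) = k) (N : Subgroup G) [hN : N.Normal] (hker : N ≤ π.ker)
    (hgen : N ⊔ σ.range = ⊤) : Nat.card G = Nat.card N * Nat.card K := by
  have hNker : N = π.ker := by
    refine le_antisymm hker fun x hx => ?_
    obtain ⟨y, hy, z, ⟨k, rfl⟩, rfl⟩ := Subgroup.mem_sup_of_normal_left.1 (hgen ▸ Subgroup.mem_top x)
    have : π y = 1 := hker hy
    have hk : k = 1 := by simpa [this, hσ] using hx
    simpa [hk] using hy
  have hsurj : Function.Surjective π := fun k => ⟨σ k, hσ k⟩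
  rw [← N.card_mul_index, hNker, Subgroup.index_ker, MonoidHom.range_eq_top.2 hsurj,
    Subgroup.card_top]

end Card

/-! ### The splitting over the dihedral quotient -/

section Structure

variable {G : Type*} [Group G] {ρ : Fin 3 → G} {m : ℕ}

/-- A homomorphism onto the dihedral group that sends `ρ 1`, `ρ 2` to the standard reflections has a
section whose range contains `⟨ρ 1, ρ 2⟩`. -/
theorem exists_section_of_dihedral (hsq : ∀ i, ρ i ^ 2 = 1) (hbc : (ρ 1 * ρ 2) ^ m = 1)
    (π : G →* DihedralGroup m) (h1 : π (ρ 1) = sr 0) (h2 : π (ρ 2) = sr 1) :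
    ∃ σ : DihedralGroup m →* G, (∀ k, π (σ k) = k) ∧ parabolic ρ {1, 2} ≤ σ.range := by
  have hσ1 := dihedralHom_sr_zero (hsq 1) (hsq 2) hbc
  have hσ2 := dihedralHom_sr_one (hsq 1) (hsq 2) hbc
  set σ := dihedralHom m (ρ 1) (ρ 2) (hsq 1) (hsq 2) hbc
  have hr : π (σ (r 1)) = r 1 := by
    have : (r 1 : DihedralGroup m) = sr 0 * sr 1 := by simp
    rw [this, map_mul, map_mul, hσ1, hσ2, h1, h2]
  have hr' (i : ZMod m) : π (σ (r i)) = r i := by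
    obtain ⟨k, rfl⟩ := ZMod.intCast_surjective i
    rw [← r_one_zpow, map_zpow, map_zpow, hr]
  refine ⟨σ, ?_, ?_⟩
  · rintro (i | i)
    · exact hr' i
    · have : (sr i : DihedralGroup m) = sr 0 * r i := by simp
      rw [this, map_mul, map_mul, hr', hσ1, h1]
  · rw [parabolic, Subgroup.closure_le, Set.image_pair]
    rintro _ (rfl | rfl)
    · exact ⟨sr 0, hσ1⟩
    · exact ⟨sr 1, hσ2⟩

/-- The section of `π` covers `⟨ρ 1, ρ 2⟩`, so `π` is injective there. The hypothesis `hab2` serves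
twice: it excludes `ρ 0 = 1` and makes the order of `ρ 0 * ρ 1` exactly 4. -/
theorem isStringCGroup_and_hasSchlafliType (hm : 1 < m) (hsq : ∀ i, ρ i ^ 2 = 1)
    (hab : (ρ 0 * ρ 1) ^ 4 = 1) (hbc : (ρ 1 * ρ 2) ^ m = 1) (hac : Commute (ρ 0) (ρ 2))
    (hgen : Subgroup.closure (Set.range ρ) = ⊤) (hab2 : (ρ 0 * ρ 1) ^ 2 ≠ 1)
    (π : G →* DihedralGroup m) (h0 : π (ρ 0) = 1) (h1 : π (ρ 1) = sr 0) (h2 : π (ρ 2) = sr 1) :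
    IsStringCGroup ρ ∧ HasSchlafliType ρ ![4, m] := by
  have : Fact (1 < m) := ⟨hm⟩
  have hsr (i : ZMod m) : (sr i : DihedralGroup m) ≠ 1 := by
    rw [one_def]
    exact fun h => nomatch h
  refine ⟨⟨fun i => orderOf_eq_prime (hsq i) ?_, hgen, ?_, ?_⟩, ?_⟩
  · fin_cases i
    · intro h
      simp only [Fin.zero_eta] at h
      exact hab2 (by rw [h, one_mul, hsq])
    · intro h
      simp only [Fin.mk_one] at h
      exact hsr 0 (by rw [← h1, h, map_one])
    · intro h
      simp only [Fin.reduceFinMk] at h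
      exact hsr 1 (by rw [← h2, h, map_one])
  · intro i j hij
    fin_cases i <;> fin_cases j <;> first | exact hac | exact hac.symm | simp at hij
  · obtain ⟨σ, hσ, hle⟩ := exists_section_of_dihedral hsq hbc π h1 h2
    refine parabolic_inf_parabolic π h0 ?_ hsq hac (by simp [h1, hsr]) (by simp [h2, hsr])
      (by simp [h1, h2])
    intro x hx hπ
    obtain ⟨k, rfl⟩ := hle hx
    rw [hσ] at hπ
    rw [hπ, map_one]
  · intro i
    fin_cases i
    · exact orderOf_eq_prime_pow (p := 2) (n := 1) (by simpa using hab2) (by simpa using hab)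
    · refine Nat.dvd_antisymm (orderOf_dvd_of_pow_eq_one hbc) ?_
      have := orderOf_map_dvd π (ρ 1 * ρ 2)
      rwa [map_mul, h1, h2, sr_mul_sr, sub_zero, orderOf_r_one] at this

/-- Stability of `⟨S⟩` under conjugation by the generators makes it normal. It contains `ρ 0` and
dies under `π`, so it is the kernel, complemented by the dihedral section of order `2 * m`. -/
theorem card_eq_card_closure_mul (hsq : ∀ i, ρ i ^ 2 = 1) (hbc : (ρ 1 * ρ 2) ^ m = 1)
    (hgen : Subgroup.closure (Set.range ρ) = ⊤)
    (π : G →* DihedralGroup m) (h1 : π (ρ 1) = sr 0) (h2 : π (ρ 2) = sr 1)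
    (S : Set G) (hρS : ρ 0 ∈ Subgroup.closure S) (hπS : ∀ s ∈ S, π s = 1)
    (hconj : ∀ i, ∀ s ∈ S, ρ i * s * ρ i ∈ Subgroup.closure S) :
    Nat.card G = Nat.card (Subgroup.closure S) * (2 * m) := by
  obtain ⟨σ, hσ, hle⟩ := exists_section_of_dihedral hsq hbc π h1 h2
  have hinv (i : Fin 3) : (ρ i)⁻¹ = ρ i :=
    inv_eq_of_mul_eq_one_left (by rw [← pow_two, hsq])
  have hconj' (i : Fin 3) (x : G) (hx : x ∈ Subgroup.closure S) :
      ρ i * x * (ρ i)⁻¹ ∈ Subgroup.closure S := by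
    induction hx using Subgroup.closure_induction with
    | mem s hs => rw [hinv]; exact hconj i s hs
    | one => simp
    | mul x y _ _ hx hy => rw [← conj_mul]; exact mul_mem hx hy
    | inv x _ hx => rw [← conj_inv]; exact inv_mem hx
  have hN : (Subgroup.closure S).Normal := by
    rw [← Subgroup.normalizer_eq_top_iff, eq_top_iff, ← hgen, Subgroup.closure_le]
    rintro _ ⟨i, rfl⟩
    rw [SetLike.mem_coe, Subgroup.mem_normalizer_iff]
    refine fun x => ⟨hconj' i x, fun hx => ?_⟩
    have := hconj' i _ hx
    rwa [hinv, mul_assoc, mul_assoc, mul_assoc, ← pow_two, hsq, mul_one, ← mul_assoc, ← pow_two,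
      hsq, one_mul] at this
  have hcard := card_eq_card_mul_of_section π σ hσ (Subgroup.closure S)
    ((Subgroup.closure_le _).2 hπS) (by
      rw [eq_top_iff, ← hgen, Subgroup.closure_le]
      rintro _ ⟨i, rfl⟩
      fin_cases i
      · exact Subgroup.mem_sup_left hρS
      · exact Subgroup.mem_sup_right (hle (Subgroup.subset_closure ⟨1, by simp, rfl⟩))
      · exact Subgroup.mem_sup_right (hle (Subgroup.subset_closure ⟨2, by simp, rfl⟩)))
  rw [hcard, nat_card]

end Structure

/-! ### Consequences of the relators for conjugates of `a` -/

section Relations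

variable {G : Type*} [Group G]

theorem comm_eq_one_iff {x y : G} : comm x y = 1 ↔ Commute x y := by
  rw [comm, mul_assoc, ← mul_inv_rev, inv_mul_eq_one, commute_iff_eq, eq_comm]

theorem commute_of_mul_sq {x y : G} (hx : x * x = 1) (hy : y * y = 1) (h : (x * y) ^ 2 = 1) :
    Commute x y := by
  have := inv_eq_of_mul_eq_one_left ((pow_two _).symm.trans h)
  rwa [mul_inv_rev, inv_eq_of_mul_eq_one_left hx, inv_eq_of_mul_eq_one_left hy, eq_comm] at this

theorem commute_conj {b x y : G} (hb : b * b = 1) (h : Commute x y) :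
    Commute (b * x * b) (b * y * b) := by
  have hb' : b⁻¹ = b := inv_eq_of_mul_eq_one_left hb
  have := (Commute.conj_iff b).2 h
  rwa [hb'] at this

theorem lift_baseRels_iff {t : ℕ} {ρ : Fin 3 → G} :
    (∀ w ∈ baseRels t, FreeGroup.lift ρ w = 1) ↔
      (∀ i, ρ i ^ 2 = 1) ∧ (ρ 0 * ρ 1) ^ 4 = 1 ∧ (ρ 1 * ρ 2) ^ 2 ^ t = 1 ∧
        (ρ 0 * ρ 2) ^ 2 = 1 := by
  simp [baseRels, Fin.forall_fin_succ]
  tauto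

theorem lift_gen (R : Set (FreeGroup (Fin 3))) (w : FreeGroup (Fin 3)) (hw : w ∈ R) :
    FreeGroup.lift (gen R) w = 1 := by
  have : FreeGroup.lift (gen R) = PresentedGroup.mk R := by
    ext i
    simp [gen, PresentedGroup.of]
  rw [this]
  exact PresentedGroup.one_of_mem hw

theorem exists_hom {R : Set (FreeGroup (Fin 3))} (f : Fin 3 → G)
    (h : ∀ w ∈ R, FreeGroup.lift f w = 1) :
    ∃ φ : PresentedGroup R →* G, ∀ i, φ (gen R i) = f i :=
  ⟨PresentedGroup.toGroup h, fun _ => PresentedGroup.toGroup.of h⟩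

theorem pow_two_pow_eq_one {x : G} (hx : x ^ 4 = 1) {t : ℕ} (ht : 2 ≤ t) : x ^ 2 ^ t = 1 := by
  obtain ⟨k, rfl⟩ := Nat.exists_eq_add_of_le ht
  rw [pow_add, pow_mul, show 2 ^ 2 = 4 from rfl, hx, one_pow]

/-- Once `ρ 0` is trivial, every relator involving it becomes an even power of an involution; this
yields `π`. -/
theorem lift_baseRels_dihedral (t : ℕ) :
    ∀ w ∈ baseRels t, FreeGroup.lift ![1, sr 0, (sr 1 : DihedralGroup (2 ^ t))] w = 1 := by
  rw [lift_baseRels_iff]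
  refine ⟨fun i => ?_, ?_, ?_, ?_⟩
  · fin_cases i <;> simp [pow_two]
  · simp [pow_succ]
  · simp
  · simp [pow_two]

/-- In the finite models `bc` has order dividing 4, so one model serves every `n` and its relations
can be decided. -/
theorem lift_baseRels_of_pow_four {t : ℕ} (ht : 2 ≤ t) {f : Fin 3 → G}
    (hsq : ∀ i, f i ^ 2 = 1) (hab : (f 0 * f 1) ^ 4 = 1) (hbc : (f 1 * f 2) ^ 4 = 1)
    (hac : (f 0 * f 2) ^ 2 = 1) : ∀ w ∈ baseRels t, FreeGroup.lift f w = 1 :=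
  lift_baseRels_iff.2 ⟨hsq, hab, pow_two_pow_eq_one hbc ht, hac⟩

variable {a b c : G}

theorem conj_conj {x : G} (hb : b * b = 1) : b * (b * x * b) * b = x := by
  simp only [mul_assoc, hb, mul_one]
  rw [← mul_assoc, hb, one_mul]

theorem conj_mul_self {x : G} (hb : b * b = 1) (hx : x * x = 1) :
    (b * x * b) * (b * x * b) = 1 := by
  calc (b * x * b) * (b * x * b) = b * (x * (b * b) * x) * b := by simp only [mul_assoc]
    _ = 1 := by rw [hb, mul_one, hx, mul_one, hb]

/-- Since `(ab)⁴ = (a · bab)²`, the relation says exactly that two involutions commute. -/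
theorem commute_conj_of_pow_four (ha : a * a = 1) (hb : b * b = 1) (hab : (a * b) ^ 4 = 1) :
    Commute a (b * a * b) := by
  refine commute_of_mul_sq ha (conj_mul_self hb ha) ?_
  rw [← hab]
  simp only [pow_succ, pow_zero, one_mul, mul_assoc]

theorem conj_eq_of_commute (hc : c * c = 1) {x : G} (h : Commute c x) : c * x * c = x := by
  rw [h.eq, mul_assoc, hc, mul_one]

/-- If `(ab)²` commutes with `c`, then `c` fixes `bab`. -/
theorem conj_eq_of_commute_sq (hc : c * c = 1) (hac : Commute a c)
    (h : Commute ((a * b) ^ 2) c) : c * (b * a * b) * c = b * a * b := by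
  refine conj_eq_of_commute hc ?_
  -- As `c` commutes with `a` and with `a · bab`, it commutes with `bab`.
  have h2 : (a * b) ^ 2 = a * (b * a * b) := by simp only [pow_two, mul_assoc]
  have := hac.inv_left.symm.mul_right (h2 ▸ h.symm)
  rwa [inv_mul_cancel_left] at this

/-- If `(ab)²` commutes with `(bc)²`, then the product of `a` and `cbabc` is that of
`bcbabcb` and `bab`. -/
theorem mul_eq_mul_of_commute_sq (hb : b * b = 1) (hc : c * c = 1)
    (hac : Commute a c) (h : Commute ((a * b) ^ 2) ((b * c) ^ 2)) :
    a * (c * (b * a * b) * c) = b * (c * (b * a * b) * c) * b * (b * a * b) := by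
  have hb' (y : G) : b * (b * y) = y := by rw [← mul_assoc, hb, one_mul]
  have hc' (y : G) : c * (c * y) = y := by rw [← mul_assoc, hc, one_mul]
  have hca : c * a = a * c := hac.eq.symm
  have hca' (y : G) : c * (a * y) = a * (c * y) := by rw [← mul_assoc, hca, mul_assoc]
  -- Since `cbcb = (bc)⁻²`, this equates `(ab)²` with its conjugate by `(bc)²`, then conjugates both
  -- by `c`.
  have key := congrArg (fun w => c * (c * b * c * b * w) * c) h.eq
  simp only [pow_two, mul_assoc, hb', hc', hca', hc, mul_one] at key ⊢
  exact key.symm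

end Relations

section Relations
variable {G : Type*} [Group G] {a b c : G}

/-- If `(bc)⁴` commutes with `a`, then `c` fixes `bcbabcb`. -/
theorem conj_eq_of_commute_pow_four (hb : b * b = 1) (hc : c * c = 1)
    (hac : Commute a c) (h : Commute a ((b * c) ^ 4)) :
    c * (b * (c * (b * a * b) * c) * b) * c = b * (c * (b * a * b) * c) * b := by
  have hb' (y : G) : b * (b * y) = y := by rw [← mul_assoc, hb, one_mul]
  have hc' (y : G) : c * (c * y) = y := by rw [← mul_assoc, hc, one_mul]
  have hca' (y : G) : c * (a * y) = a * (c * y) := by rw [← mul_assoc, ← hac.eq, mul_assoc]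
  -- Splitting `(bc)⁴` evenly, the conjugates of `a` by `(bc)²` and `(bc)⁻²` coincide; they are
  -- `bcbabcb` and its conjugate by `c`.
  have key := congrArg (fun w => c * b * c * b * w * (c * b * c * b)) h.eq
  simp only [pow_succ, pow_zero, one_mul, mul_assoc, hb', hc', hca', hb, mul_one] at key ⊢
  exact key

/-- If `[a, (bc)²]` is an involution and `(bc)⁴` commutes with `a`, then `a` and `bcbabcb`
commute. -/
theorem commute_of_comm_sq (ha : a * a = 1) (hb : b * b = 1) (hc : c * c = 1)
    (hac : Commute a c) (h4 : Commute a ((b * c) ^ 4)) (h : comm a ((b * c) ^ 2) ^ 2 = 1) :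
    Commute a (b * (c * (b * a * b) * c) * b) := by
  have hx := conj_mul_self hb (conj_mul_self hc (conj_mul_self hb ha))
  refine commute_of_mul_sq ha hx ?_
  -- The commutator is `a` times the conjugate of `bcbabcb` by `c`, and `c` fixes `bcbabcb`.
  rw [← h, ← conj_eq_of_commute_pow_four hb hc hac h4]
  congr 1
  simp only [comm, pow_two, mul_inv_rev, inv_eq_of_mul_eq_one_left ha,
    inv_eq_of_mul_eq_one_left hb, inv_eq_of_mul_eq_one_left hc, mul_assoc]

theorem map_conj_eq {H : Type*} [Group H] (θ : G →* H) {x : G} {y z : H} (hb : θ b = y)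
    (hx : θ x = z) : θ (b * x * b) = y * z * y := by
  rw [map_mul, map_mul, hb, hx]

end Relations

/-! ### The signed permutation model and the three families -/

/-- The permutation representation sending `ρ 0` to a sign change on the coordinates in `s`, and
`ρ 1`, `ρ 2` to the coordinate reflections `i ↦ u - i`, `i ↦ v - i`. -/
def signedPerm {k : ℕ} (s : ZMod k → Bool) (u v : ZMod k) :
    Fin 3 → Equiv.Perm (ZMod k × Bool) :=
  ![Equiv.prodShear (Equiv.refl _) (fun i => if s i then Equiv.boolNot else Equiv.refl _),
    Equiv.prodCongr (Equiv.subLeft u) (Equiv.refl _),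
    Equiv.prodCongr (Equiv.subLeft v) (Equiv.refl _)]

theorem stringCGroup_rels₁ {n : ℕ} (hn : 10 ≤ n) :
    IsStringCGroup (gen (rels₁ n)) ∧ Nat.card (G₁ n) = 2 ^ n ∧
      HasSchlafliType (gen (rels₁ n)) ![4, 2 ^ (n - 3)] := by
  have hgen : Subgroup.closure (Set.range (gen (rels₁ n))) = ⊤ :=
    PresentedGroup.closure_range_of _
  obtain ⟨hsq, hab, hbc, hac⟩ := lift_baseRels_iff.1
    fun w hw => lift_gen (rels₁ n) w (Or.inl hw)
  have hrel : Commute _ _ := comm_eq_one_iff.1 (by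
    simpa only [comm, map_mul, map_inv, map_pow, FreeGroup.lift_apply_of] using
      lift_gen (rels₁ n) _ (Or.inr rfl))
  obtain ⟨π, hπ⟩ := exists_hom (R := rels₁ n) ![1, sr 0, (sr 1 : DihedralGroup (2 ^ (n - 3)))] (by
    rintro w (hw | rfl)
    · exact lift_baseRels_dihedral _ w hw
    · simp [comm, pow_two])
  -- Here `a` flips coordinate 0 and `bab` flips coordinate 1, while `c` fixes both.
  obtain ⟨θ, hθ⟩ := exists_hom (R := rels₁ n) (signedPerm (k := 2) (fun i => i = 0) 1 0) (by
    rintro w (hw | rfl)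
    · exact lift_baseRels_of_pow_four (by omega) (by decide) (by decide) (by decide)
        (by decide) w hw
    · simp only [comm, map_mul, map_inv, map_pow, FreeGroup.lift_apply_of]
      decide)
  have hm : 1 < 2 ^ (n - 3) := Nat.one_lt_two_pow (by omega)
  have hθ0 := hθ 0
  have hθ1 := hθ 1
  have hθ2 := hθ 2
  have hπ0 : π (gen (rels₁ n) 0) = 1 := hπ 0
  have hπ1 : π (gen (rels₁ n) 1) = sr 0 := hπ 1
  have hπ2 : π (gen (rels₁ n) 2) = sr 1 := hπ 2
  have ha := (pow_two _).symm.trans (hsq 0)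
  have hb := (pow_two _).symm.trans (hsq 1)
  have hc := (pow_two _).symm.trans (hsq 2)
  replace hac := commute_of_mul_sq ha hc hac
  have hab2 : (gen (rels₁ n) 0 * gen (rels₁ n) 1) ^ 2 ≠ 1 := by
    intro h
    have := congrArg θ h
    simp only [map_pow, map_mul, hθ0, hθ1, map_one] at this
    exact absurd this (by decide)
  obtain ⟨hC, hT⟩ :=
    isStringCGroup_and_hasSchlafliType hm hsq hab hbc hac hgen hab2 π hπ0 hπ1 hπ2
  refine ⟨hC, ?_, hT⟩
  set a := gen (rels₁ n) 0
  set b := gen (rels₁ n) 1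
  set c := gen (rels₁ n) 2
  have h01 : Commute a (b * a * b) := commute_conj_of_pow_four ha hb hab
  have hc1 : c * (b * a * b) * c = b * a * b := conj_eq_of_commute_sq hc hac hrel
  have hθa1 := map_conj_eq θ hθ1 hθ0
  rw [card_eq_card_closure_mul hsq hbc hgen π hπ1 hπ2 {b * a * b, a}
    (Subgroup.subset_closure (by simp [a])) (by simp [hπ0, hπ1]),
    card_closure_insert θ (1, true) ((pow_two _).trans (conj_mul_self hb ha))
      (by simpa using h01.symm) (by rintro _ rfl; rw [hθ0]; decide) (by rw [hθa1]; decide),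
    ← insert_empty_eq a, card_closure_insert θ (0, true) (hsq 0) (by simp) (by simp)
      (by rw [hθ0]; decide), Subgroup.closure_empty, Subgroup.card_bot]
  · obtain ⟨k, rfl⟩ := Nat.exists_eq_add_of_le hn
    rw [show 10 + k - 3 = k + 7 by omega]
    ring
  · have conj_mem {g x y : G₁ n} (hgx : g * x * g = y)
        (hy : y ∈ ({b * a * b, a} : Set (G₁ n))) :
        g * x * g ∈ Subgroup.closure {b * a * b, a} := hgx ▸ Subgroup.subset_closure hy
    rintro i _ (rfl | rfl) <;> fin_cases i
    · exact conj_mem (conj_eq_of_commute ha h01) (by simp)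
    · exact conj_mem (conj_conj hb) (by simp)
    · exact conj_mem hc1 (by simp)
    · exact conj_mem (conj_eq_of_commute ha (Commute.refl a)) (by simp)
    · exact conj_mem rfl (by simp [b])
    · exact conj_mem (conj_eq_of_commute hc hac.symm) (by simp)

theorem stringCGroup_rels₃ {n : ℕ} (hn : 10 ≤ n) :
    IsStringCGroup (gen (rels₃ n)) ∧ Nat.card (G₃ n) = 2 ^ n ∧
      HasSchlafliType (gen (rels₃ n)) ![4, 2 ^ (n - 4)] := by
  have hgen : Subgroup.closure (Set.range (gen (rels₃ n))) = ⊤ :=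
    PresentedGroup.closure_range_of _
  obtain ⟨hsq, hab, hbc, hac⟩ := lift_baseRels_iff.1
    fun w hw => lift_gen (rels₃ n) w (Or.inl hw)
  have hrel : Commute _ _ := comm_eq_one_iff.1 (by
    simpa only [comm, map_mul, map_inv, map_pow, FreeGroup.lift_apply_of] using
      lift_gen (rels₃ n) _ (Or.inr rfl))
  obtain ⟨π, hπ⟩ := exists_hom (R := rels₃ n) ![1, sr 0, (sr 1 : DihedralGroup (2 ^ (n - 4)))] (by
    rintro w (hw | rfl)
    · exact lift_baseRels_dihedral _ w hw
    · simp [comm, pow_two])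
  -- Now `a`, `bab`, `cbabc` flip `{0, 3}`, `{0, 1}`, `{2, 3}`. Their product flips `{1, 2}`, as
  -- does `bcbabcb`, which is the dependence the relator imposes. Coordinates 2, 1, 0 then separate
  -- the three generators in turn.
  obtain ⟨θ, hθ⟩ := exists_hom (R := rels₃ n) (signedPerm (k := 4) (fun i => i = 0 ∨ i = 3) 0 3) (by
    rintro w (hw | rfl)
    · exact lift_baseRels_of_pow_four (by omega) (by decide) (by decide) (by decide)
        (by decide) w hw
    · simp only [comm, map_mul, map_inv, map_pow, FreeGroup.lift_apply_of]
      decide)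
  have hm : 1 < 2 ^ (n - 4) := Nat.one_lt_two_pow (by omega)
  have hθ0 := hθ 0
  have hθ1 := hθ 1
  have hθ2 := hθ 2
  have hπ0 : π (gen (rels₃ n) 0) = 1 := hπ 0
  have hπ1 : π (gen (rels₃ n) 1) = sr 0 := hπ 1
  have hπ2 : π (gen (rels₃ n) 2) = sr 1 := hπ 2
  have ha := (pow_two _).symm.trans (hsq 0)
  have hb := (pow_two _).symm.trans (hsq 1)
  have hc := (pow_two _).symm.trans (hsq 2)
  replace hac := commute_of_mul_sq ha hc hac
  have hab2 : (gen (rels₃ n) 0 * gen (rels₃ n) 1) ^ 2 ≠ 1 := by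
    intro h
    have := congrArg θ h
    simp only [map_pow, map_mul, hθ0, hθ1, map_one] at this
    exact absurd this (by decide)
  obtain ⟨hC, hT⟩ :=
    isStringCGroup_and_hasSchlafliType hm hsq hab hbc hac hgen hab2 π hπ0 hπ1 hπ2
  refine ⟨hC, ?_, hT⟩
  set a := gen (rels₃ n) 0
  set b := gen (rels₃ n) 1
  set c := gen (rels₃ n) 2
  have h01 : Commute a (b * a * b) := commute_conj_of_pow_four ha hb hab
  have hca : c * a * c = a := conj_eq_of_commute hc hac.symm
  have hprod := mul_eq_mul_of_commute_sq hb hc hac hrel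
  obtain ⟨a₁, ha₁⟩ : ∃ x, x = b * a * b := ⟨_, rfl⟩
  obtain ⟨a₃, ha₃⟩ : ∃ x, x = c * (b * a * b) * c := ⟨_, rfl⟩
  have hθa₁ := (congrArg θ ha₁).trans (map_conj_eq θ hθ1 hθ0)
  have hθa₃ := (congrArg θ ha₃).trans (map_conj_eq θ hθ2 (map_conj_eq θ hθ1 hθ0))
  have hπa₁ : π a₁ = 1 := by simp [ha₁, hπ0, hπ1]
  have hπa₃ : π a₃ = 1 := by simp [ha₃, hπ0, hπ1, hπ2]
  have hsq₁ : a₁ * a₁ = 1 := by rw [ha₁]; exact conj_mul_self hb ha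
  rw [← ha₃, ← ha₁] at hprod
  rw [← ha₁] at h01 ha₃
  have hsq₃ : a₃ * a₃ = 1 := by rw [ha₃]; exact conj_mul_self hc hsq₁
  have h03 : Commute a a₃ := by
    have := commute_conj hc h01
    rwa [hca, ← ha₃] at this
  have hb₁ : b * a₁ * b = a := by rw [ha₁, conj_conj hb]
  have hc₃ : c * a₃ * c = a₁ := by rw [ha₃, conj_conj hc]
  have hb₃ : b * a₃ * b = a * a₃ * a₁ := by
    rw [hprod, mul_assoc _ a₁, hsq₁, mul_one]
  have h13 : Commute a₁ a₃ := by
    -- The involution `b * a₃ * b` equals `a * (a₃ * a₁)`, and `a` commutes with `a₃ * a₁`; hence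
    -- `(a₃ * a₁)² = 1`.
    have hsq₂ := conj_mul_self hb hsq₃
    rw [hb₃] at hsq₂
    have : (a₃ * a₁) ^ 2 = 1 := by
      calc (a₃ * a₁) ^ 2 = a * a * (a₃ * a₁ * (a₃ * a₁)) := by rw [ha, one_mul, pow_two]
        _ = a * (a * (a₃ * a₁)) * (a₃ * a₁) := by simp only [mul_assoc]
        _ = a * ((a₃ * a₁) * a) * (a₃ * a₁) := by rw [(h03.mul_right h01).eq]
        _ = a * a₃ * a₁ * (a * a₃ * a₁) := by simp only [mul_assoc]
        _ = 1 := hsq₂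
    exact (commute_of_mul_sq hsq₃ hsq₁ this).symm
  rw [card_eq_card_closure_mul hsq hbc hgen π hπ1 hπ2 {a₃, a₁, a}
    (Subgroup.subset_closure (by simp [a])) (by simp [hπ0, hπa₁, hπa₃]),
    card_closure_insert θ (2, true) ((pow_two _).trans hsq₃)
      (by simpa using ⟨h13.symm, h03.symm⟩)
      (by rintro _ (rfl | rfl); · rw [hθa₁]; decide
          · rw [hθ0]; decide) (by rw [hθa₃]; decide),
    card_closure_insert θ (1, true) ((pow_two _).trans hsq₁)
      (by simpa using h01.symm) (by rintro _ rfl; rw [hθ0]; decide) (by rw [hθa₁]; decide),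
    ← insert_empty_eq a, card_closure_insert θ (0, true) (hsq 0) (by simp) (by simp)
      (by rw [hθ0]; decide), Subgroup.closure_empty, Subgroup.card_bot]
  · obtain ⟨k, rfl⟩ := Nat.exists_eq_add_of_le hn
    rw [show 10 + k - 4 = k + 6 by omega]
    ring
  · have hmem {x : G₃ n} (hx : x ∈ ({a₃, a₁, a} : Set (G₃ n))) :
        x ∈ Subgroup.closure {a₃, a₁, a} := Subgroup.subset_closure hx
    have conj_mem {g x y : G₃ n} (hgx : g * x * g = y)
        (hy : y ∈ ({a₃, a₁, a} : Set (G₃ n))) :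
        g * x * g ∈ Subgroup.closure {a₃, a₁, a} := hgx ▸ hmem hy
    have hmem₃ : b * a₃ * b ∈ Subgroup.closure {a₃, a₁, a} := by
      rw [hb₃]
      exact mul_mem (mul_mem (hmem (by simp)) (hmem (by simp))) (hmem (by simp))
    rintro i _ (rfl | rfl | rfl) <;> fin_cases i
    · exact conj_mem (conj_eq_of_commute ha h03) (by simp)
    · exact hmem₃
    · exact conj_mem hc₃ (by simp)
    · exact conj_mem (conj_eq_of_commute ha h01) (by simp)
    · exact conj_mem hb₁ (by simp)
    · exact conj_mem ha₃.symm (by simp)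
    · exact conj_mem (conj_eq_of_commute ha (Commute.refl a)) (by simp)
    · exact conj_mem ha₁.symm (by simp)
    · exact conj_mem hca (by simp)

theorem stringCGroup_rels₅ {n : ℕ} (hn : 10 ≤ n) :
    IsStringCGroup (gen (rels₅ n)) ∧ Nat.card (G₅ n) = 2 ^ n ∧
      HasSchlafliType (gen (rels₅ n)) ![4, 2 ^ (n - 5)] := by
  have hgen : Subgroup.closure (Set.range (gen (rels₅ n))) = ⊤ :=
    PresentedGroup.closure_range_of _
  obtain ⟨hsq, hab, hbc, hac⟩ := lift_baseRels_iff.1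
    fun w hw => lift_gen (rels₅ n) w (Or.inl hw)
  have hrel : comm (gen (rels₅ n) 0) ((gen (rels₅ n) 1 * gen (rels₅ n) 2) ^ 2) ^ 2 = 1 := by
    simpa only [comm, map_mul, map_inv, map_pow, FreeGroup.lift_apply_of] using
      lift_gen (rels₅ n) _ (Or.inr (Or.inl rfl))
  have hrel4 : Commute (gen (rels₅ n) 0) ((gen (rels₅ n) 1 * gen (rels₅ n) 2) ^ 4) :=
    comm_eq_one_iff.1 (by
      simpa only [comm, map_mul, map_inv, map_pow, FreeGroup.lift_apply_of] using
        lift_gen (rels₅ n) _ (Or.inr (Or.inr rfl)))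
  obtain ⟨π, hπ⟩ := exists_hom (R := rels₅ n) ![1, sr 0, (sr 1 : DihedralGroup (2 ^ (n - 5)))] (by
    rintro w (hw | rfl | rfl)
    · exact lift_baseRels_dihedral _ w hw
    · simp [comm]
    · simp [comm])
  -- The reflections are chosen so that `a` flips coordinate 0 and each `aᵢ` below flips coordinate
  -- `i` alone.
  obtain ⟨θ, hθ⟩ := exists_hom (R := rels₅ n) (signedPerm (k := 4) (fun i => i = 0) 1 0) (by
    rintro w (hw | rfl | rfl)
    · exact lift_baseRels_of_pow_four (by omega) (by decide) (by decide) (by decide)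
        (by decide) w hw
    · simp only [comm, map_mul, map_inv, map_pow, FreeGroup.lift_apply_of]
      decide
    · simp only [comm, map_mul, map_inv, map_pow, FreeGroup.lift_apply_of]
      decide)
  have hm : 1 < 2 ^ (n - 5) := Nat.one_lt_two_pow (by omega)
  have hθ0 := hθ 0
  have hθ1 := hθ 1
  have hθ2 := hθ 2
  have hπ0 : π (gen (rels₅ n) 0) = 1 := hπ 0
  have hπ1 : π (gen (rels₅ n) 1) = sr 0 := hπ 1
  have hπ2 : π (gen (rels₅ n) 2) = sr 1 := hπ 2
  have ha := (pow_two _).symm.trans (hsq 0)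
  have hb := (pow_two _).symm.trans (hsq 1)
  have hc := (pow_two _).symm.trans (hsq 2)
  replace hac := commute_of_mul_sq ha hc hac
  have hab2 : (gen (rels₅ n) 0 * gen (rels₅ n) 1) ^ 2 ≠ 1 := by
    intro h
    have := congrArg θ h
    simp only [map_pow, map_mul, hθ0, hθ1, map_one] at this
    exact absurd this (by decide)
  obtain ⟨hC, hT⟩ :=
    isStringCGroup_and_hasSchlafliType hm hsq hab hbc hac hgen hab2 π hπ0 hπ1 hπ2
  refine ⟨hC, ?_, hT⟩
  set a := gen (rels₅ n) 0
  set b := gen (rels₅ n) 1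
  set c := gen (rels₅ n) 2
  have h01 : Commute a (b * a * b) := commute_conj_of_pow_four ha hb hab
  have hca : c * a * c = a := conj_eq_of_commute hc hac.symm
  have hc₂ := conj_eq_of_commute_pow_four hb hc hac hrel4
  have h02 := commute_of_comm_sq ha hb hc hac hrel4 hrel
  obtain ⟨a₁, ha₁⟩ : ∃ x, x = b * a * b := ⟨_, rfl⟩
  rw [← ha₁] at h01 hc₂ h02
  obtain ⟨a₃, ha₃⟩ : ∃ x, x = c * a₁ * c := ⟨_, rfl⟩
  rw [← ha₃] at hc₂ h02
  obtain ⟨a₂, ha₂⟩ : ∃ x, x = b * a₃ * b := ⟨_, rfl⟩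
  rw [← ha₂] at hc₂ h02
  have hθa₁ := (congrArg θ ha₁).trans (map_conj_eq θ hθ1 hθ0)
  have hθa₃ := (congrArg θ ha₃).trans (map_conj_eq θ hθ2 hθa₁)
  have hθa₂ := (congrArg θ ha₂).trans (map_conj_eq θ hθ1 hθa₃)
  have hπa₁ : π a₁ = 1 := by simp [ha₁, hπ0, hπ1]
  have hπa₃ : π a₃ = 1 := by simp [ha₃, hπa₁, hπ2]
  have hπa₂ : π a₂ = 1 := by simp [ha₂, hπa₃, hπ1]
  have hsq₁ : a₁ * a₁ = 1 := by rw [ha₁]; exact conj_mul_self hb ha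
  have hsq₃ : a₃ * a₃ = 1 := by rw [ha₃]; exact conj_mul_self hc hsq₁
  have hsq₂ : a₂ * a₂ = 1 := by rw [ha₂]; exact conj_mul_self hb hsq₃
  have hb₁ : b * a₁ * b = a := by rw [ha₁, conj_conj hb]
  have hb₂ : b * a₂ * b = a₃ := by rw [ha₂, conj_conj hb]
  have hc₃ : c * a₃ * c = a₁ := by rw [ha₃, conj_conj hc]
  -- View `a, a₁, a₂, a₃` as the cyclically ordered vertices of a square on which `b` and `c` act as
  -- reflections. One commuting side, `h01`, gives all four sides; one commuting diagonal, `h02`,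
  -- gives the other.
  have h03 : Commute a a₃ := by
    have := commute_conj hc h01
    rwa [hca, ← ha₃] at this
  have h12 : Commute a₁ a₂ := by
    have := commute_conj hb h03
    rwa [← ha₁, ← ha₂] at this
  have h32 : Commute a₃ a₂ := by
    have := commute_conj hc h12
    rwa [← ha₃, hc₂] at this
  have h13 : Commute a₁ a₃ := by
    have := commute_conj hb h02
    rwa [← ha₁, hb₂] at this
  rw [card_eq_card_closure_mul hsq hbc hgen π hπ1 hπ2 {a₃, a₂, a₁, a}
    (Subgroup.subset_closure (by simp [a])) (by simp [hπ0, hπa₁, hπa₂, hπa₃]),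
    card_closure_insert θ (3, true) ((pow_two _).trans hsq₃)
      (by simpa using ⟨h32, h13.symm, h03.symm⟩)
      (by rintro _ (rfl | rfl | rfl)
          · rw [hθa₂]; decide
          · rw [hθa₁]; decide
          · rw [hθ0]; decide) (by rw [hθa₃]; decide),
    card_closure_insert θ (2, true) ((pow_two _).trans hsq₂)
      (by simpa using ⟨h12.symm, h02.symm⟩)
      (by rintro _ (rfl | rfl)
          · rw [hθa₁]; decide
          · rw [hθ0]; decide) (by rw [hθa₂]; decide),
    card_closure_insert θ (1, true) ((pow_two _).trans hsq₁)
      (by simpa using h01.symm) (by rintro _ rfl; rw [hθ0]; decide) (by rw [hθa₁]; decide),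
    ← insert_empty_eq a, card_closure_insert θ (0, true) (hsq 0) (by simp) (by simp)
      (by rw [hθ0]; decide), Subgroup.closure_empty, Subgroup.card_bot]
  · obtain ⟨k, rfl⟩ := Nat.exists_eq_add_of_le hn
    rw [show 10 + k - 5 = k + 5 by omega]
    ring
  · have conj_mem {g x y : G₅ n} (hgx : g * x * g = y)
        (hy : y ∈ ({a₃, a₂, a₁, a} : Set (G₅ n))) :
        g * x * g ∈ Subgroup.closure {a₃, a₂, a₁, a} := hgx ▸ Subgroup.subset_closure hy
    rintro i _ (rfl | rfl | rfl | rfl) <;> fin_cases i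
    · exact conj_mem (conj_eq_of_commute ha h03) (by simp)
    · exact conj_mem ha₂.symm (by simp)
    · exact conj_mem hc₃ (by simp)
    · exact conj_mem (conj_eq_of_commute ha h02) (by simp)
    · exact conj_mem hb₂ (by simp)
    · exact conj_mem hc₂ (by simp)
    · exact conj_mem (conj_eq_of_commute ha h01) (by simp)
    · exact conj_mem hb₁ (by simp)
    · exact conj_mem ha₃.symm (by simp)
    · exact conj_mem (conj_eq_of_commute ha (Commute.refl a)) (by simp)
    · exact conj_mem ha₁.symm (by simp)
    · exact conj_mem hca (by simp)

end StringCGroup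

theorem corollary3p1 (n : ℕ) (hn : 10 ≤ n) :
    (StringCGroup.IsStringCGroup (StringCGroup.gen (StringCGroup.rels₁ n)) ∧
      Nat.card (StringCGroup.G₁ n) = 2 ^ n ∧
      StringCGroup.HasSchlafliType (StringCGroup.gen (StringCGroup.rels₁ n))
        ![4, 2 ^ (n - 3)]) ∧
    (StringCGroup.IsStringCGroup (StringCGroup.gen (StringCGroup.rels₃ n)) ∧
      Nat.card (StringCGroup.G₃ n) = 2 ^ n ∧
      StringCGroup.HasSchlafliType (StringCGroup.gen (StringCGroup.rels₃ n))
        ![4, 2 ^ (n - 4)]) ∧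
    (StringCGroup.IsStringCGroup (StringCGroup.gen (StringCGroup.rels₅ n)) ∧
      Nat.card (StringCGroup.G₅ n) = 2 ^ n ∧
      StringCGroup.HasSchlafliType (StringCGroup.gen (StringCGroup.rels₅ n))
        ![4, 2 ^ (n - 5)]) := by
  exact ⟨StringCGroup.stringCGroup_rels₁ hn, StringCGroup.stringCGroup_rels₃ hn,
    StringCGroup.stringCGroup_rels₅ hn⟩
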